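/- Let $q>2$ be a prime power and let $K$ be a finite field containing $\mathbb F_q$ (for instance $K=\mathbb F_q$ or $K=\mathbb F_{q^2}$). Let $x_0$ be transcendental over $K$, let $x_1,x_2,\dots$ be elements of an extension field of $K(x_0)$ with $$x_{i+1}^{\,q-1}+(x_i+1)^{q-1}=1\qquad(i\ge 0),$$ and put $F_n=K(x_0,\dots,x_n)$ for $n\ge 0$. Let $\alpha\in\mathbb F_q\setminus\{-1\}$ and let $P_\alpha$ be the zero of $x_0-\alpha$ in $F_0=K(x_0)$. Then $P_\alpha$ is totally ramified in $F_{n+1}/F_n$ for every $n\ge 0$; that is, for every $n\ge 0$ and every place $P$ of $F_n$ lying above $P_\alpha$, the extension $F_{n+1}/F_n$ is finite, there is exactly one place $Q$ of $F_{n+1}$ above $P$, and its ramification index is $e(Q|P)=[F_{n+1}:F_n]$. -/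

import Mathlib

/-- A place of `F/K`, given by its valuation ring: a valuation ring `𝒪` of the field `F` with
`K ⊆ 𝒪 ⊊ F`. (If `𝒪 = K`, then every `z : F` or its inverse lies in `K`, so `𝒪 = F`; hence
`K ≠ 𝒪` is automatic.) The place itself is the maximal ideal of `𝒪`. -/
structure FunctionFieldPlace (K F : Type*) [Field K] [Field F] [Algebra K F] where
  /-- The valuation ring of the place. -/
  ring : ValuationSubring F
  algebraMap_mem : ∀ a : K, algebraMap K F a ∈ ring
  ne_top : ring ≠ ⊤

namespace FunctionFieldPlace

section

variable {K F F' : Type*} [Field K] [Field F] [Field F'] [Algebra K F] [Algebra K F']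

/-- The place `P`, that is, the maximal ideal of its valuation ring. -/
noncomputable def ideal (P : FunctionFieldPlace K F) : Ideal P.ring :=
  IsLocalRing.maximalIdeal P.ring

/-- `P` is a zero of `z`: the function `z` lies in the valuation ring of `P` and in its maximal
ideal. -/
def IsZero (P : FunctionFieldPlace K F) (z : F) : Prop :=
  ∃ h : z ∈ P.ring, (⟨z, h⟩ : P.ring) ∈ P.ideal

/-- For an extension `φ : F → F'` of fields over `K`, the place `Q` of `F'` lies above the place
`P` of `F`: the valuation ring of `P` is the intersection of that of `Q` with `F`. -/
def LiesAbove (φ : F →ₐ[K] F') (Q : FunctionFieldPlace K F') (P : FunctionFieldPlace K F) : Prop :=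
  Q.ring.comap (φ : F →+* F') = P.ring

/-- The inclusion of valuation rings `𝒪_P → 𝒪_Q` for `Q` above `P`. -/
def LiesAbove.ringHom {φ : F →ₐ[K] F'} {Q : FunctionFieldPlace K F'} {P : FunctionFieldPlace K F}
    (h : LiesAbove φ Q P) : P.ring →+* Q.ring :=
  (φ : F →+* F').restrict P.ring Q.ring fun z hz => by
    have hz' : z ∈ Q.ring.comap (φ : F →+* F') := by rw [h]; exact hz
    exact hz'

/-- The ramification index `e(Q|P)`: the largest `e` with `P 𝒪_Q ⊆ Q ^ e`. -/
noncomputable def LiesAbove.ramificationIndex {φ : F →ₐ[K] F'} {Q : FunctionFieldPlace K F'}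
    {P : FunctionFieldPlace K F} (h : LiesAbove φ Q P) : ℕ :=
  letI : Algebra P.ring Q.ring := h.ringHom.toAlgebra
  Ideal.ramificationIdx' P.ideal Q.ideal

/-- The degree `[F' : F]` of the extension `φ : F → F'`
(used only together with finiteness of the extension). -/
noncomputable def extensionDegree (φ : F →ₐ[K] F') : ℕ :=
  letI : Algebra F F' := (φ : F →+* F').toAlgebra
  Module.finrank F F'

/-- `P` is totally ramified in the finite extension `φ : F → F'`: there is exactly one place `Q` of
`F'` above `P`, and its ramification index is `e(Q|P) = [F' : F]`. -/
def IsTotallyRamified (φ : F →ₐ[K] F') (P : FunctionFieldPlace K F) : Prop :=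
  (φ : F →+* F').Finite ∧
    ∃ Q : FunctionFieldPlace K F', ∃ h : LiesAbove φ Q P,
      (∀ Q' : FunctionFieldPlace K F', LiesAbove φ Q' P → Q' = Q) ∧
        h.ramificationIndex = extensionDegree φ

end

end FunctionFieldPlace

/-- The field `F_n = K(x_0, …, x_n)` inside `E`. -/
def towerField (K : Type*) {E : Type*} [Field K] [Field E] [Algebra K E] (x : ℕ → E) (n : ℕ) :
    IntermediateField K E :=
  IntermediateField.adjoin K {y | ∃ i ≤ n, y = x i}

theorem mem_towerField (K : Type*) {E : Type*} [Field K] [Field E] [Algebra K E] (x : ℕ → E)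
    {i n : ℕ} (h : i ≤ n) : x i ∈ towerField K x n :=
  IntermediateField.subset_adjoin K _ ⟨i, h, rfl⟩

theorem towerField_mono (K : Type*) {E : Type*} [Field K] [Field E] [Algebra K E] (x : ℕ → E)
    {m n : ℕ} (h : m ≤ n) : towerField K x m ≤ towerField K x n :=
  IntermediateField.adjoin.mono K _ _ fun _ ⟨i, hi, hy⟩ => ⟨i, hi.trans h, hy⟩

/-- The inclusion `F_m → F_n` for `m ≤ n`. -/
def towerInclusion (K : Type*) {E : Type*} [Field K] [Field E] [Algebra K E] (x : ℕ → E)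
    {m n : ℕ} (h : m ≤ n) : towerField K x m →ₐ[K] towerField K x n :=
  IntermediateField.inclusion (towerField_mono K x h)

/-!
Suppose `y ^ m = t` with `t` a local parameter of a valuation of `F`. For any extension `w` of the
valuation to `F(y)`, the nonzero terms `a_i y ^ i`, `i < m`, have values `w y ^ e_i` with exponents
`e_i ≡ i` modulo `m` which do not depend on `w`. Hence `w` takes the value `w y ^ min e_i` on their
sum: so `[F(y) : F] = m`, the extension `w` is unique, and `y` is a local parameter of it, which
makes the extension totally ramified.

If `x_n - c` is a local parameter at a place of `F_n` and `c` is a simple root of `f`, then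
`f(x_n) = x_{n + 1} ^ m` is a local parameter as well, and so `x_{n + 1} = x_{n + 1} - 0` is a local
parameter at the place above. When `0` is also a simple root of `f`, this propagates up the tower.
For `f = 1 - (X + 1) ^ (q - 1)`, the elements of `𝔽_q` other than `-1` are simple roots.
-/

open Polynomial IntermediateField

section LocalParameter

/-- `t` is a local parameter of the valuation `v`: its value is less than `1` and generates the
value group. Unlike `Valuation.IsUniformizer`, this does not presuppose that `v` is discrete; it
implies it. -/
structure IsLocalParameter {F Γ : Type*} [Field F] [LinearOrderedCommGroupWithZero Γ]
    (v : Valuation F Γ) (t : F) : Prop where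
  ne_zero : t ≠ 0
  lt_one : v t < 1
  exists_zpow : ∀ z, z ≠ 0 → ∃ k : ℤ, v z = v t ^ k

variable {F Γ : Type*} [Field F] [LinearOrderedCommGroupWithZero Γ] {v : Valuation F Γ}

theorem IsLocalParameter.pos {t : F} (ht : IsLocalParameter v t) : 0 < v t :=
  v.pos_iff.2 ht.ne_zero

theorem IsLocalParameter.congr {s t : F} (ht : IsLocalParameter v t) (h : v s = v t) :
    IsLocalParameter v s where
  ne_zero := v.pos_iff.1 (h ▸ ht.pos)
  lt_one := h ▸ ht.lt_one
  exists_zpow := h ▸ ht.exists_zpow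

theorem IsLocalParameter.le_iff_lt_one {t : F} (ht : IsLocalParameter v t) (z : F) :
    v z ≤ v t ↔ v z < 1 := by
  refine ⟨fun h => h.trans_lt ht.lt_one, fun h => ?_⟩
  obtain rfl | hz := eq_or_ne z 0
  · simp
  obtain ⟨k, hk⟩ := ht.exists_zpow z hz
  rw [hk, zpow_lt_one_iff_right_of_lt_one₀ ht.pos ht.lt_one] at h
  rw [hk, ← zpow_one (v t), ← zpow_mul, one_mul,
    zpow_le_zpow_iff_right_of_lt_one₀ ht.pos ht.lt_one]
  lia

section TrivialOnConstants

variable {K : Type*} [Field K] [Algebra K F] [v.IsTrivialOn K]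

theorem valuation_algebraMap_le_one (c : K) : v (algebraMap K F c) ≤ 1 := by
  obtain rfl | hc := eq_or_ne c 0
  · simp
  · exact (Valuation.IsTrivialOn.eq_one c hc).le

theorem valuation_aeval_le_one {z : F} (hz : v z ≤ 1) (p : K[X]) : v (aeval z p) ≤ 1 := by
  rw [aeval_eq_sum_range]
  refine v.map_sum_le fun i _ => ?_
  rw [Algebra.smul_def, map_mul, map_pow]
  exact mul_le_one' (valuation_algebraMap_le_one _) (pow_le_one' hz i)

theorem valuation_aeval_eq_one {z : F} {c : K} (hz : v (z - algebraMap K F c) < 1) {p : K[X]}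
    (hp : ¬p.IsRoot c) : v (aeval z p) = 1 := by
  have hval : v (algebraMap K F (p.eval c)) = 1 := Valuation.IsTrivialOn.eq_one _ hp
  have hz1 : v z ≤ 1 := by
    simpa using v.map_add_le hz.le (valuation_algebraMap_le_one c)
  have hlt : v (aeval z ((X - C c) * (p /ₘ (X - C c)))) < 1 := by
    rw [map_mul, map_mul]
    exact mul_lt_one_of_lt_of_le (by simpa using hz) (valuation_aeval_le_one hz1 _)
  rw [← modByMonic_add_div p (X - C c), modByMonic_X_sub_C_eq_C_eval, map_add, aeval_C,
    v.map_add_eq_of_lt_left (hval ▸ hlt), hval]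

theorem valuation_aeval_eq_pow_rootMultiplicity {z : F} {c : K}
    (hz : v (z - algebraMap K F c) < 1) {p : K[X]} (hp : p ≠ 0) :
    v (aeval z p) = v (z - algebraMap K F c) ^ p.rootMultiplicity c := by
  obtain ⟨r, hpr, hr⟩ := exists_eq_pow_rootMultiplicity_mul_and_not_dvd p hp c
  conv_lhs => rw [hpr]
  rw [map_mul, map_mul, valuation_aeval_eq_one hz (mt dvd_iff_isRoot.2 hr), mul_one]
  simp

theorem isLocalParameter_sub_algebraMap {z : F} (hz : Transcendental K z) (hgen : K⟮z⟯ = ⊤)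
    {c : K} (hlt : v (z - algebraMap K F c) < 1) :
    IsLocalParameter v (z - algebraMap K F c) where
  ne_zero h := hz (sub_eq_zero.1 h ▸ isAlgebraic_algebraMap c)
  lt_one := hlt
  exists_zpow w hw := by
    obtain ⟨p, r, rfl⟩ := (mem_adjoin_simple_iff K w).1 (hgen ▸ mem_top)
    obtain ⟨hp, hr⟩ := div_ne_zero_iff.1 hw
    have hpos : v (z - algebraMap K F c) ≠ 0 := by
      rw [v.ne_zero_iff]
      exact fun h => hz (sub_eq_zero.1 h ▸ isAlgebraic_algebraMap c)
    refine ⟨p.rootMultiplicity c - r.rootMultiplicity c, ?_⟩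
    rw [map_div₀, valuation_aeval_eq_pow_rootMultiplicity hlt (by rintro rfl; simp at hp),
      valuation_aeval_eq_pow_rootMultiplicity hlt (by rintro rfl; simp at hr), zpow_sub₀ hpos,
      zpow_natCast, zpow_natCast]

theorem IsLocalParameter.aeval_of_rootMultiplicity_eq_one {z : F} {c : K}
    (hz : IsLocalParameter v (z - algebraMap K F c)) {f : K[X]} (hf : f.rootMultiplicity c = 1) :
    IsLocalParameter v (aeval z f) := by
  refine hz.congr ?_
  rw [valuation_aeval_eq_pow_rootMultiplicity hz.lt_one (by rintro rfl; simp at hf), hf, pow_one]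

end TrivialOnConstants

end LocalParameter

section RootOfLocalParameter

variable {F F' Γ : Type*} [Field F] [Field F'] [Algebra F F'] [LinearOrderedCommGroupWithZero Γ]
  {v : Valuation F Γ} {t : F} {y : F'} {m : ℕ}

theorem natDegree_minpoly_le_of_pow_eq (hm : m ≠ 0) (hy : y ^ m = algebraMap F F' t) :
    (minpoly F y).natDegree ≤ m := by
  rw [← natDegree_X_pow_sub_C (n := m) (r := t)]
  exact natDegree_le_of_dvd (minpoly.dvd F y (by simp [hy])) (X_pow_sub_C_ne_zero hm.bot_lt t)

theorem isIntegral_of_pow_eq (hm : m ≠ 0) (hy : y ^ m = algebraMap F F' t) : IsIntegral F y :=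
  .of_pow hm.bot_lt (hy ▸ isIntegral_algebraMap)

theorem IsLocalParameter.ne_zero_of_pow_eq (ht : IsLocalParameter v t) (hm : m ≠ 0)
    (hy : y ^ m = algebraMap F F' t) : y ≠ 0 := by
  rintro rfl
  exact ht.ne_zero (by simpa [hm] using hy.symm)

section Extension

variable {Γ' : Type*} [LinearOrderedCommGroupWithZero Γ'] (w : Valuation F' Γ') [v.HasExtension w]

theorem IsLocalParameter.lt_one_of_pow_eq (ht : IsLocalParameter v t)
    (hm : m ≠ 0) (hy : y ^ m = algebraMap F F' t) : w y < 1 := by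
  rw [← pow_lt_one_iff hm, ← map_pow, hy, Valuation.HasExtension.val_map_lt_one_iff v w]
  exact ht.lt_one

theorem valuation_algebraMap_eq_zpow (hy : y ^ m = algebraMap F F' t) {a : F} {k : ℤ}
    (ha : v a = v t ^ k) : w (algebraMap F F' a) = w y ^ (m * k) := by
  rw [← map_zpow₀, ← Valuation.HasExtension.val_map_eq_iff v w] at ha
  rw [ha, map_zpow₀, ← hy, map_zpow₀, map_pow, zpow_mul, zpow_natCast]

end Extension

theorem IsLocalParameter.exists_valuation_aeval_eq_zpow_of_pow_eq (ht : IsLocalParameter v t)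
    (hy : y ^ m = algebraMap F F' t) {p : F[X]} (hp : p ≠ 0) (hdeg : p.natDegree < m) :
    ∃ e : ℤ, ∀ {Γ' : Type*} [LinearOrderedCommGroupWithZero Γ'] (w : Valuation F' Γ')
      [v.HasExtension w], w (aeval y p) = w y ^ e := by
  have hm : m ≠ 0 := hdeg.ne_bot
  have hlt {i : ℕ} (hi : i ∈ p.support) : i < m := (le_natDegree_of_mem_supp i hi).trans_lt hdeg
  choose! k hk using ht.exists_zpow
  let e (i : ℕ) : ℤ := m * k (p.coeff i) + i
  have he_inj {i j : ℕ} (hi : i ∈ p.support) (hj : j ∈ p.support) (hij : e i = e j) : i = j := by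
    have hmod : (i : ℤ) % m = j % m := by
      simpa only [e, Int.mul_add_emod_self_left] using congrArg (· % (m : ℤ)) hij
    rw [← Nat.mod_eq_of_lt (hlt hi), ← Nat.mod_eq_of_lt (hlt hj)]
    exact_mod_cast hmod
  obtain ⟨j, hj, hmin⟩ := p.support.exists_min_image e (nonempty_support_iff.2 hp)
  refine ⟨e j, fun {Γ'} _ w _ => ?_⟩
  have hpos : 0 < w y := w.pos_iff.2 (ht.ne_zero_of_pow_eq hm hy)
  have hterm {i : ℕ} (hi : i ∈ p.support) :
      w (algebraMap F F' (p.coeff i) * y ^ i) = w y ^ e i := by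
    rw [map_mul, valuation_algebraMap_eq_zpow w hy (hk _ (mem_support_iff.1 hi)), map_pow,
      ← zpow_natCast, ← zpow_add₀ hpos.ne']
  rw [aeval_def, eval₂_eq_sum, Polynomial.sum_def, ← hterm hj]
  refine w.map_sum_eq_of_lt hj fun i hi => ?_
  rw [Finset.mem_sdiff, Finset.notMem_singleton] at hi
  rw [hterm hi.1, hterm hj]
  exact zpow_lt_zpow_right_of_lt_one₀ hpos (ht.lt_one_of_pow_eq w hm hy)
    ((hmin i hi.1).lt_of_ne fun h => hi.2 (he_inj hi.1 hj h.symm))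

theorem IsLocalParameter.natDegree_minpoly_eq_of_pow_eq {Γ' : Type*}
    [LinearOrderedCommGroupWithZero Γ'] (w : Valuation F' Γ') [v.HasExtension w]
    (ht : IsLocalParameter v t) (hm : m ≠ 0) (hy : y ^ m = algebraMap F F' t) :
    (minpoly F y).natDegree = m := by
  refine (natDegree_minpoly_le_of_pow_eq hm hy).eq_of_not_lt fun hlt => ?_
  obtain ⟨e, he⟩ := ht.exists_valuation_aeval_eq_zpow_of_pow_eq hy
    (minpoly.ne_zero (isIntegral_of_pow_eq hm hy)) hlt
  have hzero : w y ^ e = 0 := by rw [← he w, minpoly.aeval, map_zero]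
  exact zpow_ne_zero e (w.ne_zero_iff.2 (ht.ne_zero_of_pow_eq hm hy)) hzero

theorem exists_powerBasis_gen_eq (hint : IsIntegral F y) (hgen : F⟮y⟯ = ⊤) :
    ∃ B : PowerBasis F F', B.gen = y :=
  ⟨.ofAdjoinEqTop hint ((adjoin_simple_eq_top_iff_of_isAlgebraic hint.isAlgebraic).1 hgen), rfl⟩

theorem finite_of_pow_eq (hm : m ≠ 0) (hy : y ^ m = algebraMap F F' t) (hgen : F⟮y⟯ = ⊤) :
    Module.Finite F F' := by
  obtain ⟨B, -⟩ := exists_powerBasis_gen_eq (isIntegral_of_pow_eq hm hy) hgen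
  exact B.finite

theorem IsLocalParameter.finrank_eq_of_pow_eq {Γ' : Type*} [LinearOrderedCommGroupWithZero Γ']
    (w : Valuation F' Γ') [v.HasExtension w] (ht : IsLocalParameter v t) (hm : m ≠ 0)
    (hy : y ^ m = algebraMap F F' t) (hgen : F⟮y⟯ = ⊤) : Module.finrank F F' = m := by
  obtain ⟨B, rfl⟩ := exists_powerBasis_gen_eq (isIntegral_of_pow_eq hm hy) hgen
  rw [B.finrank, ← B.natDegree_minpoly, ht.natDegree_minpoly_eq_of_pow_eq w hm hy]

theorem IsLocalParameter.exists_valuation_eq_zpow_of_pow_eq (ht : IsLocalParameter v t) (hm : m ≠ 0)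
    (hy : y ^ m = algebraMap F F' t) (hgen : F⟮y⟯ = ⊤) {z : F'} (hz : z ≠ 0) :
    ∃ e : ℤ, ∀ {Γ' : Type*} [LinearOrderedCommGroupWithZero Γ'] (w : Valuation F' Γ')
      [v.HasExtension w], w z = w y ^ e := by
  obtain ⟨B, rfl⟩ := exists_powerBasis_gen_eq (isIntegral_of_pow_eq hm hy) hgen
  obtain ⟨p, hdeg, rfl⟩ := B.exists_eq_aeval z
  rw [← B.natDegree_minpoly] at hdeg
  exact ht.exists_valuation_aeval_eq_zpow_of_pow_eq hy (by rintro rfl; simp at hz)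
    (hdeg.trans_le (natDegree_minpoly_le_of_pow_eq hm hy))

theorem IsLocalParameter.of_pow_eq {Γ' : Type*} [LinearOrderedCommGroupWithZero Γ']
    (w : Valuation F' Γ') [v.HasExtension w] (ht : IsLocalParameter v t) (hm : m ≠ 0)
    (hy : y ^ m = algebraMap F F' t) (hgen : F⟮y⟯ = ⊤) : IsLocalParameter w y where
  ne_zero := ht.ne_zero_of_pow_eq hm hy
  lt_one := ht.lt_one_of_pow_eq w hm hy
  exists_zpow _ hz := (ht.exists_valuation_eq_zpow_of_pow_eq hm hy hgen hz).imp fun _ he => he w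

theorem IsLocalParameter.valuationSubring_eq_of_pow_eq (V₁ V₂ : ValuationSubring F')
    [v.HasExtension V₁.valuation] [v.HasExtension V₂.valuation] (ht : IsLocalParameter v t)
    (hm : m ≠ 0) (hy : y ^ m = algebraMap F F' t) (hgen : F⟮y⟯ = ⊤) : V₁ = V₂ := by
  ext z
  obtain rfl | hz := eq_or_ne z 0
  · exact iff_of_true V₁.zero_mem V₂.zero_mem
  have hy0 := ht.ne_zero_of_pow_eq hm hy
  obtain ⟨e, he⟩ := ht.exists_valuation_eq_zpow_of_pow_eq hm hy hgen hz
  rw [← V₁.valuation_le_one_iff, ← V₂.valuation_le_one_iff, he V₁.valuation,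
    he V₂.valuation,
    zpow_le_one_iff_right_of_lt_one₀ (V₁.valuation.pos_iff.2 hy0) (ht.lt_one_of_pow_eq _ hm hy),
    zpow_le_one_iff_right_of_lt_one₀ (V₂.valuation.pos_iff.2 hy0) (ht.lt_one_of_pow_eq _ hm hy)]

end RootOfLocalParameter

theorem exists_valuationSubring_comap_eq {F F' : Type*} [Field F] [Field F'] (φ : F →+* F')
    (O : ValuationSubring F) : ∃ V : ValuationSubring F', V.comap φ = O := by
  obtain ⟨V, hmem, hloc⟩ := IsLocalRing.exists_factor_valuationRing (φ.comp O.subtype)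
  refine ⟨V, le_antisymm (fun z hz => ?_) fun z hz => hmem ⟨z, hz⟩⟩
  by_contra hzO
  have hz0 : z ≠ 0 := by rintro rfl; exact hzO O.zero_mem
  have hinv : z⁻¹ ∈ O := (O.mem_or_inv_mem z).resolve_left hzO
  have hunit : IsUnit (⟨z⁻¹, hinv⟩ : O) := hloc.map_nonunit _ <|
    .of_mul_eq_one ⟨φ z, hz⟩ <| Subtype.ext <| by
      change φ z⁻¹ * φ z = 1
      rw [← map_mul, inv_mul_cancel₀ hz0, map_one]
  obtain ⟨u, hu⟩ := hunit.exists_right_inv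
  have huz : z⁻¹ * u = 1 := congrArg Subtype.val hu
  rw [inv_mul_eq_one₀ hz0] at huz
  exact hzO (huz ▸ u.2)

theorem adjoin_simple_eq_top_of_fieldRange_sup_eq_top {K F F' : Type*} [Field K] [Field F]
    [Field F'] [Algebra K F] [Algebra K F'] [Algebra F F'] [IsScalarTower K F F'] {y : F'}
    (h : (IsScalarTower.toAlgHom K F F').fieldRange ⊔ K⟮y⟯ = ⊤) : F⟮y⟯ = ⊤ := by
  rw [← restrictScalars_eq_top_iff (K := K), eq_top_iff, ← h]
  refine sup_le ?_ (adjoin_simple_le_iff.2 (mem_adjoin_simple_self F y))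
  rintro _ ⟨a, rfl⟩
  exact F⟮y⟯.algebraMap_mem a

namespace FunctionFieldPlace

variable {K F F' F'' : Type*} [Field K] [Field F] [Field F'] [Field F''] [Algebra K F]
  [Algebra K F'] [Algebra K F''] {φ : F →ₐ[K] F'} {ψ : F' →ₐ[K] F''}

theorem eq_of_ring_eq {P Q : FunctionFieldPlace K F} (h : P.ring = Q.ring) : P = Q := by
  cases P
  cases Q
  cases h
  rfl

theorem isZero_iff {P : FunctionFieldPlace K F} {z : F} :
    P.IsZero z ↔ P.ring.valuation z < 1 := by
  refine ⟨fun ⟨_, hz⟩ => (P.ring.valuation_lt_one_iff _).1 hz, fun hz => ?_⟩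
  exact ⟨(P.ring.valuation_le_one_iff z).1 hz.le, (P.ring.valuation_lt_one_iff _).2 hz⟩

instance (P : FunctionFieldPlace K F) : P.ring.valuation.IsTrivialOn K where
  eq_one c hc := by
    refine le_antisymm ((P.ring.valuation_le_one_iff _).2 (P.algebraMap_mem c)) ?_
    have hinv := (P.ring.valuation_le_one_iff _).2 (P.algebraMap_mem c⁻¹)
    rw [map_inv₀, map_inv₀] at hinv
    exact (inv_le_one₀ (P.ring.valuation.pos_iff.2 ((_root_.map_ne_zero _).2 hc))).1 hinv

theorem mem_ring_of_isLocalParameter {P : FunctionFieldPlace K F} {t : F}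
    (ht : IsLocalParameter P.ring.valuation t) : t ∈ P.ring :=
  (P.ring.valuation_le_one_iff t).1 ht.lt_one.le

theorem ideal_eq_span {P : FunctionFieldPlace K F} {t : F}
    (ht : IsLocalParameter P.ring.valuation t) :
    P.ideal = Ideal.span {⟨t, mem_ring_of_isLocalParameter ht⟩} := by
  ext z
  rw [ideal, P.ring.valuation_lt_one_iff, ← ht.le_iff_lt_one, P.ring.valuation_le_iff,
    Ideal.mem_span_singleton']
  simp only [Subtype.ext_iff, MulMemClass.coe_mul]

theorem LiesAbove.hasExtension [Algebra F F'] {Q : FunctionFieldPlace K F'}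
    {P : FunctionFieldPlace K F} (hφ : (φ : F →+* F') = algebraMap F F') (h : LiesAbove φ Q P) :
    P.ring.valuation.HasExtension Q.ring.valuation := by
  refine ⟨Valuation.isEquiv_of_val_le_one fun z => ?_⟩
  rw [Valuation.comap_apply, ValuationSubring.valuation_le_one_iff,
    ValuationSubring.valuation_le_one_iff, ← h, ValuationSubring.mem_comap, hφ]

theorem exists_liesAbove (φ : F →ₐ[K] F') (P : FunctionFieldPlace K F) :
    ∃ Q : FunctionFieldPlace K F', LiesAbove φ Q P := by
  obtain ⟨V, hV⟩ := exists_valuationSubring_comap_eq (φ : F →+* F') P.ring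
  refine ⟨⟨V, fun a => ?_, ?_⟩, hV⟩
  · have ha := P.algebraMap_mem a
    rw [← hV, ValuationSubring.mem_comap] at ha
    simpa using ha
  · rintro rfl
    exact P.ne_top hV.symm

theorem LiesAbove.exists_of_comp {Q : FunctionFieldPlace K F''} {P : FunctionFieldPlace K F}
    (h : LiesAbove (ψ.comp φ) Q P) :
    ∃ P' : FunctionFieldPlace K F', LiesAbove ψ Q P' ∧ LiesAbove φ P' P := by
  refine ⟨⟨Q.ring.comap (ψ : F' →+* F''), fun a => ?_, fun htop => P.ne_top ?_⟩, rfl, h⟩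
  · simpa using Q.algebraMap_mem a
  · have hcomap : (Q.ring.comap (ψ : F' →+* F'')).comap (φ : F →+* F') = P.ring := h
    rw [← hcomap, htop]
    rfl

theorem LiesAbove.ramificationIndex_eq_of_pow_eq {Q : FunctionFieldPlace K F'}
    {P : FunctionFieldPlace K F} (h : LiesAbove φ Q P) {t : F} {y : F'} {m : ℕ}
    (ht : IsLocalParameter P.ring.valuation t) (hyQ : IsLocalParameter Q.ring.valuation y)
    (hy : y ^ m = φ t) : h.ramificationIndex = m := by
  let : Algebra P.ring Q.ring := h.ringHom.toAlgebra
  let y₀ : Q.ring := ⟨y, mem_ring_of_isLocalParameter hyQ⟩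
  have hideal : Q.ideal = Ideal.span {y₀} := ideal_eq_span hyQ
  have hmap : P.ideal.map (algebraMap P.ring Q.ring) = Q.ideal ^ m := by
    rw [ideal_eq_span ht, Ideal.map_span, Set.image_singleton, hideal, Ideal.span_singleton_pow]
    congr 2
    exact Subtype.ext hy.symm
  have hy0 : y₀ ≠ 0 := fun h0 => hyQ.ne_zero (congrArg Subtype.val h0)
  have hunit : ¬IsUnit y₀ := fun hu => hyQ.lt_one.ne ((Q.ring.valuation_eq_one_iff _).1 hu)
  refine Ideal.ramificationIdx'_spec hmap.le ?_
  rw [hmap, hideal, Ideal.span_singleton_pow, Ideal.span_singleton_pow,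
    Ideal.span_singleton_le_span_singleton, pow_dvd_pow_iff hy0 hunit]
  lia

theorem LiesAbove.isLocalParameter_of_pow_eq {Q : FunctionFieldPlace K F'}
    {P : FunctionFieldPlace K F} (h : LiesAbove φ Q P) {t : F} {y : F'} {m : ℕ}
    (ht : IsLocalParameter P.ring.valuation t) (hm : m ≠ 0) (hy : y ^ m = φ t)
    (hgen : φ.fieldRange ⊔ K⟮y⟯ = ⊤) : IsLocalParameter Q.ring.valuation y := by
  let : Algebra F F' := (φ : F →+* F').toAlgebra
  have : IsScalarTower K F F' := .of_algebraMap_eq fun a => (φ.commutes a).symm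
  have := h.hasExtension rfl
  exact ht.of_pow_eq _ hm hy (adjoin_simple_eq_top_of_fieldRange_sup_eq_top hgen)

theorem isTotallyRamified_of_pow_eq {P : FunctionFieldPlace K F} {t : F} {y : F'} {m : ℕ}
    (ht : IsLocalParameter P.ring.valuation t) (hm : m ≠ 0) (hy : y ^ m = φ t)
    (hgen : φ.fieldRange ⊔ K⟮y⟯ = ⊤) : IsTotallyRamified φ P := by
  let : Algebra F F' := (φ : F →+* F').toAlgebra
  have : IsScalarTower K F F' := .of_algebraMap_eq fun a => (φ.commutes a).symm
  have htop : F⟮y⟯ = ⊤ := adjoin_simple_eq_top_of_fieldRange_sup_eq_top hgen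
  obtain ⟨Q, hQ⟩ := exists_liesAbove φ P
  have := hQ.hasExtension rfl
  refine ⟨finite_of_pow_eq hm hy htop, Q, hQ, fun Q' hQ' => ?_, ?_⟩
  · have := hQ'.hasExtension rfl
    exact eq_of_ring_eq (ht.valuationSubring_eq_of_pow_eq _ _ hm hy htop)
  · rw [hQ.ramificationIndex_eq_of_pow_eq ht (hQ.isLocalParameter_of_pow_eq ht hm hy hgen) hy]
    exact (ht.finrank_eq_of_pow_eq Q.ring.valuation hm hy htop).symm

end FunctionFieldPlace

section Tower

variable {K E : Type*} [Field K] [Field E] [Algebra K E]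

/-- The generator `x_n`, as an element of `F_n = K(x_0, …, x_n)`. -/
def towerGenerator (K : Type*) {E : Type*} [Field K] [Field E] [Algebra K E] (x : ℕ → E) (n : ℕ) :
    towerField K x n :=
  ⟨x n, mem_towerField K x le_rfl⟩

theorem towerField_zero (x : ℕ → E) : towerField K x 0 = K⟮x 0⟯ := by
  simp [towerField]

theorem towerField_succ (x : ℕ → E) (n : ℕ) :
    towerField K x (n + 1) = towerField K x n ⊔ K⟮x (n + 1)⟯ := by
  rw [towerField, towerField, ← adjoin_union]
  congr 1
  ext y
  simp only [Nat.le_succ_iff, or_and_right, exists_or, exists_eq_left, Set.mem_union,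
    Set.mem_ofPred_eq, Set.mem_singleton_iff]

theorem val_comp_inclusion {A B : IntermediateField K E} (h : A ≤ B) :
    B.val.comp (inclusion h) = A.val :=
  AlgHom.ext fun _ => rfl

theorem val_towerGenerator (x : ℕ → E) (n : ℕ) :
    (towerField K x n).val (towerGenerator K x n) = x n :=
  rfl

theorem val_comp_towerInclusion (x : ℕ → E) {i n : ℕ} (h : i ≤ n) :
    (towerField K x n).val.comp (towerInclusion K x h) = (towerField K x i).val :=
  val_comp_inclusion (towerField_mono K x h)

theorem towerInclusion_comp_towerInclusion (x : ℕ → E) {i j n : ℕ} (hij : i ≤ j) (hjn : j ≤ n) :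
    (towerInclusion K x hjn).comp (towerInclusion K x hij) = towerInclusion K x (hij.trans hjn) :=
  AlgHom.ext fun a => inclusion_inclusion (towerField_mono K x hij) (towerField_mono K x hjn) a

theorem adjoin_towerGenerator_zero (x : ℕ → E) : K⟮towerGenerator K x 0⟯ = ⊤ := by
  refine map_injective (towerField K x 0).val ?_
  rw [adjoin_map, ← AlgHom.fieldRange_eq_map, fieldRange_val, Set.image_singleton,
    val_towerGenerator, towerField_zero]

theorem fieldRange_towerInclusion_sup_adjoin (x : ℕ → E) (n : ℕ) :
    (towerInclusion K x (Nat.le_succ n)).fieldRange ⊔ K⟮towerGenerator K x (n + 1)⟯ = ⊤ := by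
  refine map_injective (towerField K x (n + 1)).val ?_
  rw [IntermediateField.map_sup, adjoin_map, AlgHom.map_fieldRange, val_comp_towerInclusion,
    ← AlgHom.fieldRange_eq_map, fieldRange_val, fieldRange_val, Set.image_singleton,
    val_towerGenerator, towerField_succ]

variable {x : ℕ → E} {m : ℕ} {f : K[X]}

theorem transcendental_towerGenerator (n : ℕ) (h : Transcendental K (x n)) :
    Transcendental K (towerGenerator K x n) :=
  fun halg => h (halg.algHom (towerField K x n).val)

theorem towerGenerator_succ_pow {n : ℕ} (h : x (n + 1) ^ m = aeval (x n) f) :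
    towerGenerator K x (n + 1) ^ m =
      towerInclusion K x (Nat.le_succ n) (aeval (towerGenerator K x n) f) := by
  refine Subtype.ext ?_
  have haeval := aeval_algHom_apply (towerField K x n).val (towerGenerator K x n) f
  exact h.trans haeval

theorem exists_isLocalParameter_towerGenerator_sub (hm : m ≠ 0)
    (hx0 : Transcendental K (x 0)) (hx : ∀ i, x (i + 1) ^ m = aeval (x i) f)
    (hf0 : f.rootMultiplicity 0 = 1) {α : K} (hfα : f.rootMultiplicity α = 1)
    {Pα : FunctionFieldPlace K (towerField K x 0)}
    (hPα : Pα.IsZero (towerGenerator K x 0 - algebraMap K (towerField K x 0) α))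
    {n : ℕ} {P : FunctionFieldPlace K (towerField K x n)}
    (hP : P.LiesAbove (towerInclusion K x (Nat.zero_le n)) Pα) :
    ∃ c : K, f.rootMultiplicity c = 1 ∧ IsLocalParameter P.ring.valuation
      (towerGenerator K x n - algebraMap K (towerField K x n) c) := by
  induction n with
  | zero =>
    obtain rfl : P = Pα := FunctionFieldPlace.eq_of_ring_eq hP
    exact ⟨α, hfα, isLocalParameter_sub_algebraMap (transcendental_towerGenerator 0 hx0)
      (adjoin_towerGenerator_zero x) (FunctionFieldPlace.isZero_iff.1 hPα)⟩
  | succ n ih =>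
    rw [← towerInclusion_comp_towerInclusion x (Nat.zero_le n) (Nat.le_succ n)] at hP
    obtain ⟨P', hPP', hP'⟩ := hP.exists_of_comp
    obtain ⟨c, hfc, hc⟩ := ih hP'
    refine ⟨0, hf0, ?_⟩
    rw [map_zero, sub_zero]
    exact hPP'.isLocalParameter_of_pow_eq (hc.aeval_of_rootMultiplicity_eq_one hfc) hm
      (towerGenerator_succ_pow (hx n)) (fieldRange_towerInclusion_sup_adjoin x n)

end Tower

theorem proposition2p2_general {K E : Type*} [Field K] [Field E] [Algebra K E] {m : ℕ} (hm : m ≠ 0)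
    {f : K[X]} (x : ℕ → E) (hx0 : Transcendental K (x 0))
    (hx : ∀ i, x (i + 1) ^ m = aeval (x i) f) (hf0 : f.rootMultiplicity 0 = 1)
    {α : K} (hfα : f.rootMultiplicity α = 1) (Pα : FunctionFieldPlace K (towerField K x 0))
    (hPα : Pα.IsZero (towerGenerator K x 0 - algebraMap K (towerField K x 0) α))
    (n : ℕ) (P : FunctionFieldPlace K (towerField K x n))
    (hP : P.LiesAbove (towerInclusion K x (Nat.zero_le n)) Pα) :
    P.IsTotallyRamified (towerInclusion K x (Nat.le_succ n)) := by
  obtain ⟨c, hfc, hc⟩ := exists_isLocalParameter_towerGenerator_sub hm hx0 hx hf0 hfα hPα hP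
  exact FunctionFieldPlace.isTotallyRamified_of_pow_eq (hc.aeval_of_rootMultiplicity_eq_one hfc) hm
    (towerGenerator_succ_pow (hx n)) (fieldRange_towerInclusion_sup_adjoin x n)

theorem rootMultiplicity_one_sub_X_add_one_pow {K : Type*} [Field K] {m : ℕ} (hm : (m : K) ≠ 0)
    {c : K} (hc : (c + 1) ^ m = 1) : (1 - (X + 1) ^ m : K[X]).rootMultiplicity c = 1 := by
  have hc0 : c + 1 ≠ 0 := by
    rintro h
    rw [h, zero_pow (by rintro rfl; simp at hm)] at hc
    exact zero_ne_one hc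
  have hder : ¬(derivative (1 - (X + 1) ^ m : K[X])).IsRoot c := by
    simp [IsRoot.def, derivative_pow, hm, hc0]
  have hne : (1 - (X + 1) ^ m : K[X]) ≠ 0 := fun h => hder (by simp [h])
  refine le_antisymm (not_lt.1 fun h => ?_) ((rootMultiplicity_pos hne).2 (by simp [hc]))
  exact hder ((one_lt_rootMultiplicity_iff_isRoot hne).1 h).2

theorem rootMultiplicity_algebraMap_one_sub_X_add_one_pow {k K : Type*} [Field k] [Finite k]
    [Field K] [Algebra k K] {a : k} (ha : a ≠ -1) :
    (1 - (X + 1) ^ (Nat.card k - 1) : K[X]).rootMultiplicity (algebraMap k K a) = 1 := by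
  have := Fintype.ofFinite k
  have hcard : (Nat.card k : K) = 0 := by
    rw [← map_natCast (algebraMap k K), Nat.card_eq_fintype_card, FiniteField.cast_card_eq_zero,
      map_zero]
  refine rootMultiplicity_one_sub_X_add_one_pow ?_ ?_
  · rw [Nat.cast_pred Nat.card_pos, hcard]
    simp
  · rw [← map_one (algebraMap k K), ← map_add, ← map_pow, Nat.card_eq_fintype_card,
      FiniteField.pow_card_sub_one_eq_one _ fun h => ha (eq_neg_of_add_eq_zero_left h)]

theorem proposition2p2
    {k K E : Type*} [Field k] [Field K] [Field E] [Finite k] [Finite K] [Algebra k K] [Algebra K E]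
    (q : ℕ) (hq : Nat.card k = q) (hq2 : 2 < q)
    (x : ℕ → E) (hx0 : Transcendental K (x 0))
    (hx : ∀ i : ℕ, x (i + 1) ^ (q - 1) + (x i + 1) ^ (q - 1) = 1)
    (α : k) (hα : α ≠ -1)
    (Pα : FunctionFieldPlace K (towerField K x 0))
    (hPα : Pα.IsZero
      ((⟨x 0, mem_towerField K x le_rfl⟩ : towerField K x 0) -
        algebraMap K (towerField K x 0) (algebraMap k K α)))
    (n : ℕ) :
    ∀ P : FunctionFieldPlace K (towerField K x n),
      FunctionFieldPlace.LiesAbove (towerInclusion K x (Nat.zero_le n)) P Pα →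
        FunctionFieldPlace.IsTotallyRamified (towerInclusion K x (Nat.le_succ n)) P := by
  subst hq
  have hroot {a : k} (ha : a ≠ -1) := rootMultiplicity_algebraMap_one_sub_X_add_one_pow (K := K) ha
  exact proposition2p2_general (Nat.sub_ne_zero_of_lt (one_lt_two.trans hq2)) x hx0
    (fun i => by simpa using eq_sub_of_add_eq (hx i))
    (map_zero (algebraMap k K) ▸ hroot (neg_ne_zero.2 one_ne_zero).symm) (hroot hα) Pα hPα n
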